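/- Let $m\ge 1$ and let $M_1,\dots,M_m$ be smooth manifolds (Hausdorff, second countable, without boundary, of possibly different finite dimensions). Let $\mu_i$ be a compactly supported Borel probability measure on $M_i$ for $i=1,\dots,m$, and let $c:M_1\times\cdots\times M_m\to\mathbb R$ be continuous and semi-concave, i.e. near every point of $M_1\times\cdots\times M_m$, in the product of local coordinate charts on the factors, there is a constant $C$ such that $c(v)-C|v|^2$ is concave. Consider the multi-marginal Monge–Kantorovich problem of minimizing $$\int_{M_1\times\cdots\times M_m} c(x_1,\dots,x_m)\,d\gamma$$ among the Borel probability measures $\gamma$ on $M_1\times\cdots\times M_m$ whose $i$-th marginal is $\mu_i$ for every $i$. A set $S\subseteq M_1\times\cdots\times M_m$ is called $c$-cyclically monotone if for all $N$, all points $x^1,\dots,x^N\in S$ (not necessarily distinct) and all permutations $\sigma_1,\dots,\sigma_m$ of $\{1,\dots,N\}$, $$\sum_{l=1}^N c(x_1^l,\dots,x_m^l)\le\sum_{l=1}^N c\big(x_1^{\sigma_1(l)},\dots,x_m^{\sigma_m(l)}\big).$$ Assume that $c$ is twisted in $c$-cyclical monotonicity: for every $x_1\in M_1$ and every $c$-cyclically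 monotone set $S\subseteq\{x_1\}\times M_2\times\cdots\times M_m$, the map $(x_2,\dots,x_m)\mapsto D_{x_1}c(x_1,x_2,\dots,x_m)\in T^*_{x_1}M_1$ is injective on the set of those $(x_2,\dots,x_m)$ for which $(x_1,x_2,\dots,x_m)\in S$ and $c$ is differentiable with respect to $x_1$ at $(x_1,x_2,\dots,x_m)$. Assume also that $\mu_1$ is absolutely continuous with respect to local coordinates, i.e. in every coordinate chart of $M_1$ the preimage of each Lebesgue null set is $\mu_1$-null. Then the minimization problem has exactly one solution $\gamma$, and this $\gamma$ induces a Monge solution: there is a Borel map $T:M_1\to M_2\times\cdots\times M_m$ such that $\gamma$ is concentrated on the graph $\{(x_1,T(x_1)) : x_1\in M_1\}$. -/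

import Mathlib

open MeasureTheory Topology
open scoped Manifold ContDiff

namespace MultiMarginal

/-- A plan (coupling) for `μ`: a Borel probability measure on the product whose `i`-th marginal
is `μ i` for every `i`. -/
structure IsPlan {k : ℕ} {M : Fin (k + 1) → Type*} [∀ i, MeasurableSpace (M i)]
    (μ : ∀ i, Measure (M i)) (γ : Measure (∀ i, M i)) : Prop where
  isProbabilityMeasure : IsProbabilityMeasure γ
  map_eval : ∀ i, γ.map (fun x => x i) = μ i

/-- `γ` minimizes `∫ c dγ` among all plans for `μ`. (For a continuous `c` and compactly supported
marginals, `c` is integrable with respect to every plan.) -/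
def IsOptimalPlan {k : ℕ} {M : Fin (k + 1) → Type*} [∀ i, MeasurableSpace (M i)]
    (c : (∀ i, M i) → ℝ) (μ : ∀ i, Measure (M i)) (γ : Measure (∀ i, M i)) : Prop :=
  IsPlan μ γ ∧ ∀ γ' : Measure (∀ i, M i), IsPlan μ γ' → ∫ x, c x ∂γ ≤ ∫ x, c x ∂γ'

/-- `γ` induces a Monge solution: it is concentrated on the graph `{(x, T x)}` of a Borel map `T`
from the first factor to the product of the remaining factors. -/
def InducesMongeSolution {k : ℕ} {M : Fin (k + 1) → Type*} [∀ i, MeasurableSpace (M i)]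
    (γ : Measure (∀ i, M i)) : Prop :=
  ∃ T : M 0 → ∀ j : Fin k, M j.succ, Measurable T ∧
    ∀ᵐ x ∂γ, (fun j : Fin k => x j.succ) = T (x 0)

/-- `c`-cyclical monotonicity: for points `X 0, …, X (N - 1)` of `S` and one permutation `σ j` for
each factor `j`, the permuted points do not have a smaller total cost. -/
def IsCyclicallyMonotone {k : ℕ} {M : Fin (k + 1) → Type*} (c : (∀ i, M i) → ℝ)
    (S : Set (∀ i, M i)) : Prop :=
  ∀ (N : ℕ) (X : Fin N → ∀ i, M i), (∀ l, X l ∈ S) →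
    ∀ σ : Fin (k + 1) → Equiv.Perm (Fin N),
      ∑ l, c (X l) ≤ ∑ l, c (fun j => X (σ j l) j)

section Manifolds

variable {k : ℕ} (n : Fin (k + 1) → ℕ) {M : Fin (k + 1) → Type*} [∀ i, TopologicalSpace (M i)]
  [∀ i, ChartedSpace (EuclideanSpace ℝ (Fin (n i))) (M i)]

/-- Semi-concavity (in local coordinates) of a function on the product of the manifolds `M i`:
near every point `p`, in the product of the charts at the `p i`, the function becomes concave after
subtracting `C * |v|^2` for some constant `C`. -/
def IsSemiconcave (c : (∀ i, M i) → ℝ) : Prop :=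
  ∀ p : ∀ i, M i,
    ∃ U ∈ 𝓝 (fun i => chartAt (EuclideanSpace ℝ (Fin (n i))) (p i) (p i)),
      (∀ v ∈ U, ∀ i, v i ∈ (chartAt (EuclideanSpace ℝ (Fin (n i))) (p i)).target) ∧
      ∃ C : ℝ, ConcaveOn ℝ U (fun v : ∀ i, EuclideanSpace ℝ (Fin (n i)) =>
        c (fun i => (chartAt (EuclideanSpace ℝ (Fin (n i))) (p i)).symm (v i))
          - C * ∑ i, ‖v i‖ ^ 2)

/-- `c` is differentiable with respect to the first variable at `(x₁, z)`. -/
def DifferentiableInFirst (c : (∀ i, M i) → ℝ) (x₁ : M 0) (z : ∀ j : Fin k, M j.succ) : Prop :=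
  MDifferentiableAt (𝓡 (n 0)) 𝓘(ℝ, ℝ) (fun y : M 0 => c (Fin.cons y z)) x₁

/-- The differential `D_{x₁} c (x₁, z)`, a covector at `x₁`. -/
noncomputable def derivInFirst (c : (∀ i, M i) → ℝ) (x₁ : M 0) (z : ∀ j : Fin k, M j.succ) :
    TangentSpace (𝓡 (n 0)) x₁ →L[ℝ] ℝ :=
  mfderiv (𝓡 (n 0)) 𝓘(ℝ, ℝ) (fun y : M 0 => c (Fin.cons y z)) x₁

/-- `c` is twisted in `c`-cyclical monotonicity: for every `x₁` and every `c`-cyclically monotone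
subset `S` of `{x₁} × M 1 × ⋯ × M k`, the map `z ↦ D_{x₁} c (x₁, z)` is injective on the part of
`S` where that differential exists. -/
def IsTwistedInCyclicalMonotonicity (c : (∀ i, M i) → ℝ) : Prop :=
  ∀ (x₁ : M 0) (S : Set (∀ i, M i)), (∀ x ∈ S, x 0 = x₁) → IsCyclicallyMonotone c S →
    Set.InjOn (fun z : ∀ j : Fin k, M j.succ => derivInFirst n c x₁ z)
      {z | (Fin.cons x₁ z : ∀ i, M i) ∈ S ∧ DifferentiableInFirst n c x₁ z}

end Manifolds

/-- Absolute continuity with respect to local coordinates: in every chart of the atlas, Lebesgue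
null sets pull back to `μ`-null sets. -/
def IsAbsolutelyContinuousInCharts (d : ℕ) {X : Type*} [TopologicalSpace X]
    [ChartedSpace (EuclideanSpace ℝ (Fin d)) X] [MeasurableSpace X] (μ : Measure X) : Prop :=
  ∀ e ∈ atlas (EuclideanSpace ℝ (Fin d)) X, ∀ s : Set (EuclideanSpace ℝ (Fin d)),
    volume s = 0 → μ (e.source ∩ e ⁻¹' s) = 0

end MultiMarginal

/-! Existence is compactness: all plans live on the compact product of the marginal supports, so
they form a weakly compact set. For an optimal `γ`, rearranging a little mass near a violating tuple
would lower the cost, so `γ.support` is `c`-cyclically monotone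
(`IsOptimalPlan.isCyclicallyMonotone_support`). Keeping the first coordinate and permuting all the
others together gives a two-marginal problem, for which Rockafellar's construction yields prices `φ`
(`exists_price_of_cyclicallyMonotone`). The envelope `w y = inf_q (c (y, tail q) - φ q)` is
semi-concave, hence differentiable `μ 0`-a.e., and the infimum at `p 0` is attained at `q = p`. Each
attaining function touches `w` from above, and semi-concavity makes it differentiable there with the
derivative of `w` (`ae_derivInFirst_eq_of_price`). Thus `D_{x₁} c` is constant on almost every fibre
of the support, and the twist condition, applied to that fibre, leaves at most one point. Uniqueness
follows because the average of two optimal plans is optimal, so both sit on one graph and are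
determined by `μ 0`. -/

namespace MultiMarginal

/-! ### Couplings and existence of an optimal plan -/

section Plans

variable {k : ℕ} {M : Fin (k + 1) → Type*} [∀ i, MeasurableSpace (M i)]
  {μ : ∀ i, Measure (M i)} {c : (∀ i, M i) → ℝ} {γ : Measure (∀ i, M i)}

lemma IsPlan.of_map_eval [∀ i, IsProbabilityMeasure (μ i)]
    (h : ∀ i, γ.map (fun x => x i) = μ i) : IsPlan μ γ := by
  refine ⟨⟨?_⟩, h⟩
  have h0 : γ.map (fun x => x 0) Set.univ = 1 := by rw [h 0]; exact measure_univ
  rwa [Measure.map_apply (measurable_pi_apply 0) MeasurableSet.univ, Set.preimage_univ] at h0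

variable [∀ i, TopologicalSpace (M i)]

/-- The product of the supports of the marginals. -/
def supportBox (μ : ∀ i, Measure (M i)) : Set (∀ i, M i) :=
  Set.univ.pi fun i => (μ i).support

lemma isCompact_supportBox (hμ : ∀ i, IsCompact (μ i).support) : IsCompact (supportBox μ) :=
  isCompact_univ_pi hμ

lemma isClosed_supportBox : IsClosed (supportBox μ) :=
  isClosed_set_pi fun _ _ => Measure.isClosed_support

variable [∀ i, SecondCountableTopology (M i)]

lemma IsPlan.ae_mem_supportBox (h : IsPlan μ γ) : ∀ᵐ x ∂γ, x ∈ supportBox μ := by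
  simp only [supportBox, Set.mem_univ_pi, ae_all_iff]
  intro i
  have hi : ∀ᵐ y ∂(γ.map fun x => x i), y ∈ (μ i).support := by
    rw [h.map_eval i]; exact Measure.support_mem_ae
  exact ae_of_ae_map (measurable_pi_apply i).aemeasurable hi

variable [∀ i, BorelSpace (M i)] [∀ i, T2Space (M i)]

lemma IsPlan.integrable (hμ : ∀ i, IsCompact (μ i).support) (hc : Continuous c)
    (h : IsPlan μ γ) : Integrable c γ := by
  have := h.isProbabilityMeasure
  have hi : IntegrableOn c (supportBox μ) γ :=
    hc.continuousOn.integrableOn_compact (isCompact_supportBox hμ)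
  rwa [IntegrableOn, Measure.restrict_eq_self_of_ae_mem h.ae_mem_supportBox] at hi

theorem exists_isOptimalPlan [∀ i, TopologicalSpace.MetrizableSpace (M i)]
    [∀ i, IsProbabilityMeasure (μ i)]
    (hμ : ∀ i, IsCompact (μ i).support) (hc : Continuous c) :
    ∃ γ, IsOptimalPlan c μ γ := by
  have hK := isCompact_supportBox hμ
  obtain ⟨B, hB⟩ := hK.exists_bound_of_continuousOn hc.continuousOn
  -- Weak convergence only tests bounded functions; truncating at `|B|` does not change `c` on the
  -- box that carries every plan.
  let g : BoundedContinuousFunction (∀ i, M i) ℝ :=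
    BoundedContinuousFunction.ofNormedAddCommGroup (fun x => max (-|B|) (min |B| (c x)))
      (by fun_prop) |B| (fun x => by
        rw [Real.norm_eq_abs, abs_le]
        exact ⟨le_max_left _ _, max_le (by linarith [abs_nonneg B]) (min_le_left _ _)⟩)
  have hg : ∀ γ', IsPlan μ γ' → ∫ x, c x ∂γ' = ∫ x, g x ∂γ' := by
    intro γ' h
    refine integral_congr_ae ?_
    filter_upwards [h.ae_mem_supportBox] with x hx
    have h1 := abs_le.1 ((hB x hx).trans (le_abs_self B))
    change c x = max (-|B|) (min |B| (c x))
    rw [min_eq_right h1.2, max_eq_right h1.1]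
  let Q : Set (ProbabilityMeasure (∀ i, M i)) := {γ' | IsPlan μ (γ' : Measure (∀ i, M i))}
  let ν : ∀ i, ProbabilityMeasure (M i) := fun i => ⟨μ i, inferInstance⟩
  have hclosed : IsClosed Q := by
    have hQ : Q = ⋂ i, {γ' | γ'.map (measurable_pi_apply i).aemeasurable = ν i} := by
      ext γ'
      simp only [Q, Set.mem_ofPred_eq, Set.mem_iInter]
      refine ⟨fun h i => Subtype.ext (h.map_eval i), fun h => IsPlan.of_map_eval fun i => ?_⟩
      exact congrArg Subtype.val (h i)
    rw [hQ]
    refine isClosed_iInter fun i => ?_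
    have hcont := ProbabilityMeasure.continuous_map (continuous_apply (A := M) i)
    have hsing : IsClosed ({ν i} : Set (ProbabilityMeasure (M i))) := isClosed_singleton
    exact hsing.preimage hcont
  -- Prokhorov: the box has full mass for every plan, so tightness holds with error `0`.
  have hcomp : IsCompact Q := by
    refine (isCompact_setOfPred_probabilityMeasure_mass_eq_compl_isCompact_le
      (E := ∀ i, M i) (u := fun _ => 0) (K := fun _ => supportBox μ) tendsto_const_nhds
      (fun _ => hK) (Or.inr monotone_const)).of_isClosed_subset hclosed ?_
    intro γ' h _
    have h0 : (γ' : Measure (∀ i, M i)) (supportBox μ)ᶜ = 0 := h.ae_mem_supportBox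
    exact ((ProbabilityMeasure.null_iff_toMeasure_null γ' _).2 h0).le
  have hne : Q.Nonempty := by
    refine ⟨⟨Measure.pi μ, inferInstance⟩, IsPlan.of_map_eval fun i => ?_⟩
    exact (measurePreserving_eval μ i).map_eq
  obtain ⟨γ₀, h₀, hmin⟩ := hcomp.exists_isMinOn hne
    (ProbabilityMeasure.continuous_integral_boundedContinuousFunction g).continuousOn
  refine ⟨γ₀, h₀, fun γ' h => ?_⟩
  rw [hg _ h₀, hg _ h]
  exact hmin (show (⟨γ', h.isProbabilityMeasure⟩ : ProbabilityMeasure _) ∈ Q from h)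

end Plans

/-- Gives the cost of a plan before and after the rearrangement in a common form, so that the
untouched part `ρ` cancels. -/
lemma integral_add_sum_smul_map {Ω Ω' ι : Type*} [MeasurableSpace Ω] [MeasurableSpace Ω']
    [Fintype ι] {c : Ω → ℝ} (hc : Measurable c) {ρ : Measure Ω} {P : Measure Ω'}
    {f : ι → Ω' → Ω} (hf : ∀ l, Measurable (f l)) {δ : ENNReal} (hδ : δ ≠ 0) (hδ' : δ ≠ ⊤)
    (hi : Integrable c (ρ + ∑ l, δ • P.map (f l))) :
    (∀ l, Integrable (fun y => c (f l y)) P) ∧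
      ∫ x, c x ∂(ρ + ∑ l, δ • P.map (f l))
        = ∫ x, c x ∂ρ + δ.toReal * ∑ l, ∫ y, c (f l y) ∂P := by
  have h1 := integrable_add_measure.1 hi
  have h2 : ∀ l, Integrable c (δ • P.map (f l)) := fun l =>
    (integrable_finsetSum_measure.1 h1.2) l (Finset.mem_univ l)
  have h3 : ∀ l, Integrable c (P.map (f l)) := fun l =>
    (integrable_smul_measure hδ hδ').1 (h2 l)
  refine ⟨fun l => (integrable_map_measure hc.aestronglyMeasurable (hf l).aemeasurable).1 (h3 l),
    ?_⟩
  rw [integral_add_measure h1.1 h1.2, integral_finsetSum_measure fun l _ => h2 l, Finset.mul_sum]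
  congr 1
  refine Finset.sum_congr rfl fun l _ => ?_
  rw [integral_smul_measure, integral_map (hf l).aemeasurable hc.aestronglyMeasurable, smul_eq_mul]

/-! ### Cyclical monotonicity of the support -/

section CyclicalMonotonicity

variable {k : ℕ} {M : Fin (k + 1) → Type*} [∀ i, TopologicalSpace (M i)]
  [∀ i, SecondCountableTopology (M i)] [∀ i, MeasurableSpace (M i)] [∀ i, BorelSpace (M i)]
  [∀ i, T2Space (M i)]
  {μ : ∀ i, Measure (M i)} {c : (∀ i, M i) → ℝ} {γ : Measure (∀ i, M i)}

theorem IsOptimalPlan.isCyclicallyMonotone_support [∀ i, IsProbabilityMeasure (μ i)]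
    (hμ : ∀ i, IsCompact (μ i).support) (hc : Continuous c) (h : IsOptimalPlan c μ γ) :
    IsCyclicallyMonotone c γ.support := by
  intro N X hX σ
  by_contra! hlt
  have := h.1.isProbabilityMeasure
  let τ : Fin N → (Fin N → ∀ i, M i) → ∀ i, M i := fun l Y j => Y (σ j l) j
  have hτ : ∀ l, Continuous (τ l) := fun l => by fun_prop
  have hopen : IsOpen {Y : Fin N → ∀ i, M i | ∑ l, c (τ l Y) < ∑ l, c (Y l)} :=
    isOpen_lt (continuous_finsetSum _ fun l _ => hc.comp (hτ l))
      (continuous_finsetSum _ fun l _ => hc.comp (continuous_apply l))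
  -- By continuity the violation persists for all tuples in a product of neighbourhoods, each of
  -- positive mass.
  obtain ⟨U, hU, hUsub⟩ := isOpen_pi_iff'.1 hopen X hlt
  have hpos : ∀ l, γ (U l) ≠ 0 := fun l =>
    ((Measure.mem_support_iff_forall _).1 (hX l) _ ((hU l).1.mem_nhds (hU l).2)).ne'
  have hN : Nonempty (Fin N) := by
    by_contra hN
    rw [not_nonempty_iff] at hN
    simp at hlt
  have hN0 : (N : ENNReal) ≠ 0 := by
    simpa using Nat.pos_iff_ne_zero.1 (Fin.pos_iff_nonempty.2 hN)
  obtain ⟨l₀, hl₀⟩ := Finite.exists_min fun l => γ (U l)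
  let γU : Fin N → Measure (∀ i, M i) := fun l => ProbabilityTheory.cond γ (U l)
  have hγU : ∀ l, IsProbabilityMeasure (γU l) := fun l =>
    ProbabilityTheory.cond_isProbabilityMeasure (hpos l)
  -- Under `P` the points `Y l` are independent with law `γ` conditioned on `U l`. The competitor
  -- replaces mass `δ` of each `Y l` by mass `δ` of `τ l Y`; with `δ = min γ (U l) / N` each removed
  -- piece is at most `γ / N`.
  let P : Measure (Fin N → ∀ i, M i) := Measure.pi γU
  let δ : ENNReal := γ (U l₀) * (N : ENNReal)⁻¹
  have hδ : δ ≠ 0 := mul_ne_zero (hpos l₀) (ENNReal.inv_ne_zero.2 (ENNReal.natCast_ne_top N))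
  have hδ' : δ ≠ ⊤ := ENNReal.mul_ne_top (measure_ne_top _ _) (ENNReal.inv_ne_top.2 hN0)
  have hPe : ∀ l, P.map (fun Y => Y l) = γU l := fun l => (measurePreserving_eval γU l).map_eq
  have hle : ∑ l, δ • P.map (fun Y => Y l) ≤ γ := by
    refine Measure.le_iff.2 fun s hs => ?_
    have h1 : ∀ l, (δ • P.map (fun Y => Y l)) s ≤ (N : ENNReal)⁻¹ * γ s := by
      intro l
      rw [hPe, Measure.smul_apply, smul_eq_mul, ProbabilityTheory.cond_apply (hU l).1.measurableSet]
      calc δ * ((γ (U l))⁻¹ * γ (U l ∩ s))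
          ≤ (γ (U l) * (N : ENNReal)⁻¹) * ((γ (U l))⁻¹ * γ s) := by
            refine mul_le_mul' (mul_le_mul_left (hl₀ l) _) ?_
            gcongr
            exact Set.inter_subset_right
        _ = (γ (U l) * (γ (U l))⁻¹) * ((N : ENNReal)⁻¹ * γ s) := by ring
        _ = (N : ENNReal)⁻¹ * γ s := by
            rw [ENNReal.mul_inv_cancel (hpos l) (measure_ne_top _ _), one_mul]
    rw [Measure.finsetSum_apply]
    refine (Finset.sum_le_sum fun l _ => h1 l).trans ?_
    rw [Finset.sum_const, Finset.card_univ, Fintype.card_fin, nsmul_eq_mul, ← mul_assoc,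
      ENNReal.mul_inv_cancel hN0 (ENNReal.natCast_ne_top N), one_mul]
  have hfin : IsFiniteMeasure (∑ l, δ • P.map (fun Y => Y l)) := isFiniteMeasure_of_le γ hle
  obtain ⟨ρ, hρ⟩ : ∃ ρ : Measure (∀ i, M i), ρ + ∑ l, δ • P.map (fun Y => Y l) = γ :=
    ⟨_, Measure.sub_add_cancel_of_le hle⟩
  have hplan : IsPlan μ (ρ + ∑ l, δ • P.map (τ l)) := by
    refine IsPlan.of_map_eval fun j => ?_
    rw [← h.1.map_eval j, ← hρ]
    have hm : Measurable fun x : ∀ i, M i => x j := measurable_pi_apply j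
    simp only [Measure.map_add _ _ hm, ← Measure.mapₗ_apply_of_measurable hm, map_sum, map_smul]
    simp only [Measure.mapₗ_apply_of_measurable hm]
    congr 1
    have h2 : ∀ l, (P.map (τ l)).map (fun x => x j)
        = (P.map fun Y => Y (σ j l)).map (fun x => x j) := by
      intro l
      rw [Measure.map_map hm (hτ l).measurable, Measure.map_map hm (measurable_pi_apply _)]
      rfl
    simp only [h2]
    -- In factor `j` the rearrangement only reorders the summands by `σ j`, so the marginal is
    -- unchanged.
    exact Equiv.sum_comp (σ j) fun l => δ • (P.map fun Y => Y l).map (fun x => x j)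
  have hi₁ := h.1.integrable hμ hc
  rw [← hρ] at hi₁
  obtain ⟨hi₁, he₁⟩ := integral_add_sum_smul_map hc.measurable
    (fun l => measurable_pi_apply l) hδ hδ' hi₁
  obtain ⟨hi₂, he₂⟩ := integral_add_sum_smul_map hc.measurable
    (fun l => (hτ l).measurable) hδ hδ' (hplan.integrable hμ hc)
  have hopt := h.2 _ hplan
  rw [he₂, ← hρ, he₁, add_le_add_iff_left,
    mul_le_mul_iff_right₀ (ENNReal.toReal_pos hδ hδ'), ← integral_finsetSum _ fun l _ => hi₁ l,
    ← integral_finsetSum _ fun l _ => hi₂ l] at hopt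
  have hae : ∀ᵐ Y ∂P, ∑ l, c (τ l Y) < ∑ l, c (Y l) := by
    have h3 : ∀ᵐ Y ∂P, ∀ l, Y l ∈ U l := by
      refine ae_all_iff.2 fun l => ?_
      have h4 : ∀ᵐ x ∂(P.map fun Y => Y l), x ∈ U l := by
        rw [hPe]
        exact ProbabilityTheory.ae_cond_mem (hU l).1.measurableSet
      exact ae_of_ae_map (measurable_pi_apply l).aemeasurable h4
    filter_upwards [h3] with Y hY using hUsub fun l _ => hY l
  have hle' : (fun Y => ∑ l, c (τ l Y)) ≤ᵐ[P] fun Y => ∑ l, c (Y l) := hae.mono fun _ => le_of_lt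
  have hi₁' := integrable_finsetSum Finset.univ fun l _ => hi₁ l
  have hi₂' := integrable_finsetSum Finset.univ fun l _ => hi₂ l
  have heq := (integral_eq_iff_of_ae_le hi₂' hi₁' hle').1
    (le_antisymm (integral_mono_ae hi₂' hi₁' hle') hopt)
  obtain ⟨Y, h5, h6⟩ := (hae.and heq).exists
  exact h5.ne h6

end CyclicalMonotonicity

/-! ### Rockafellar prices -/

/-- Cost increment along the chain `p 0, …, p N`, where the matrix entry `b x y` is the cost of
pairing the source of `x` with the target of `y`. -/
def chainCost {P : Type*} (b : P → P → ℝ) (p : ℕ → P) (N : ℕ) : ℝ :=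
  ∑ i ∈ Finset.range N, (b (p (i + 1)) (p i) - b (p i) (p i))

/-- Closing the chain turns it into a cycle, and this is the hypothesis for the inverse rotation of
`p 0, …, p N`, reindexed. -/
lemma chainCost_add_closing_nonneg {P : Type*} {b : P → P → ℝ}
    (hb : ∀ (N : ℕ) (p : Fin N → P) (σ : Equiv.Perm (Fin N)),
      ∑ l, b (p l) (p l) ≤ ∑ l, b (p l) (p (σ l))) (p : ℕ → P) (N : ℕ) :
    0 ≤ chainCost b p N + (b (p 0) (p N) - b (p N) (p N)) := by
  have h := hb (N + 1) (fun l => p l) (finRotate (N + 1)).symm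
  rw [← Equiv.sum_comp (finRotate (N + 1)) fun l : Fin (N + 1) =>
    b (p l) (p ((finRotate (N + 1)).symm l : Fin (N + 1)))] at h
  simp only [Equiv.symm_apply_apply] at h
  rw [Fin.sum_univ_castSucc, Fin.sum_univ_castSucc] at h
  simp only [Fin.val_castSucc, Fin.val_last, finRotate_last, Fin.val_zero] at h
  have h1 : ∀ i : Fin N, ((finRotate (N + 1) i.castSucc : Fin (N + 1)) : ℕ) = i + 1 := by
    intro i
    rw [coe_finRotate_of_ne_last (Fin.castSucc_lt_last i).ne, Fin.val_castSucc]
  simp only [h1] at h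
  rw [Fin.sum_univ_eq_sum_range (fun i => b (p i) (p i)) N,
    Fin.sum_univ_eq_sum_range (fun i => b (p (i + 1)) (p i)) N] at h
  rw [chainCost, Finset.sum_sub_distrib]
  linarith

/-- Existence of Rockafellar potentials for an abstract cost matrix: a cyclically monotone
matrix admits prices. -/
theorem exists_price_of_cyclicallyMonotone {P : Type*} {b : P → P → ℝ}
    (hb : ∀ (N : ℕ) (p : Fin N → P) (σ : Equiv.Perm (Fin N)),
      ∑ l, b (p l) (p l) ≤ ∑ l, b (p l) (p (σ l))) :
    ∃ φ : P → ℝ, ∀ p q, b p p - φ p ≤ b p q - φ q := by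
  rcases isEmpty_or_nonempty P with hP | ⟨⟨p₀⟩⟩
  · exact ⟨fun _ => 0, fun p => (hP.false p).elim⟩
  -- `A x` collects the costs of all chains from `p₀` to `x`.
  let A : P → Set ℝ := fun x =>
    {a | ∃ (N : ℕ) (p : ℕ → P), p 0 = p₀ ∧ a = chainCost b p N + (b x (p N) - b (p N) (p N))}
  have hne : ∀ x, (A x).Nonempty := fun x => ⟨_, 0, fun _ => p₀, rfl, rfl⟩
  have hext : ∀ x y, ∀ a ∈ A x, a + (b y x - b x x) ∈ A y := by
    rintro x y _ ⟨N, p, hp, rfl⟩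
    refine ⟨N + 1, fun i => if i ≤ N then p i else x, by simp [hp], ?_⟩
    have h1 : chainCost b (fun i => if i ≤ N then p i else x) N = chainCost b p N := by
      refine Finset.sum_congr rfl fun i hi => ?_
      have hi := Finset.mem_range.1 hi
      simp [hi.le, Nat.succ_le_of_lt hi]
    have h2 : chainCost b (fun i => if i ≤ N then p i else x) (N + 1)
        = chainCost b p N + (b x (p N) - b (p N) (p N)) := by
      rw [← h1, chainCost, Finset.sum_range_succ]
      simp [chainCost]
    rw [h2]
    simp
  have hbdd : ∀ x, BddBelow (A x) := by
    intro x
    -- Returning from `x` to `p₀` closes a cycle, whose cost is nonnegative.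
    refine ⟨-(b p₀ x - b x x), fun a ha => ?_⟩
    obtain ⟨N, p, hp, h⟩ := hext x p₀ a ha
    have := chainCost_add_closing_nonneg hb p N
    rw [hp] at this
    linarith
  -- With this choice `b p p - φ p` is the cheapest chain cost to `p`, and the claim is its one-step
  -- inequality from `q` to `p`.
  refine ⟨fun x => b x x - sInf (A x), fun x q => ?_⟩
  have h : sInf (A x) - (b x q - b q q) ≤ sInf (A q) :=
    le_csInf (hne q) fun a ha => by linarith [csInf_le (hbdd x) (hext q x a ha)]
  linarith

/-! ### Concave functions, touching and differentiability -/

section Semiconcave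

variable {E : Type*} [NormedAddCommGroup E] [NormedSpace ℝ E]

/-- A concave function touched from below by a differentiable function is differentiable. -/
lemma hasFDerivAt_of_concaveOn_of_le {s : Set E} {g h : E → ℝ} {h' : E →L[ℝ] ℝ} {x : E}
    (hs : s ∈ 𝓝 x) (hg : ConcaveOn ℝ s g) (hle : ∀ y ∈ s, h y ≤ g y) (heq : h x = g x)
    (hh : HasFDerivAt h h' x) : HasFDerivAt g h' x := by
  rw [hasFDerivAt_iff_isLittleO_nhds_zero] at hh ⊢
  have hneg : Filter.Tendsto (fun v : E => -v) (𝓝 0) (𝓝 0) := by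
    simpa using (continuous_neg (G := E)).tendsto 0
  have hh₂ : (fun v => h (x + -v) - h x - h' (-v)) =o[𝓝 0] fun v : E => v :=
    (hh.comp_tendsto hneg).neg_right.congr (fun _ => rfl) (fun v => by simp)
  refine Asymptotics.IsBigO.trans_isLittleO ?_ (hh.abs_left.add hh₂.abs_left)
  have hadd : Filter.Tendsto (fun v : E => x + v) (𝓝 0) (𝓝 x) := by
    simpa using (continuous_const_add x).tendsto (0 : E)
  have hx := mem_of_mem_nhds hs
  refine Asymptotics.IsBigO.of_bound 1 ?_
  filter_upwards [hadd hs, (hadd.comp hneg) hs] with v hv hv'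
  have hv' : x + -v ∈ s := hv'
  -- Midpoint concavity gives `g (x + v) - g x ≤ g x - g (x - v) ≤ h x - h (x - v)`, while `h ≤ g`
  -- bounds the left side below. The error of `g` at `v` is squeezed between errors of `h` at `v`
  -- and `-v`.
  have hmid := hg.2 hv hv' (by norm_num : (0 : ℝ) ≤ 1 / 2) (by norm_num : (0 : ℝ) ≤ 1 / 2)
    (by norm_num)
  have hpt : (1 / 2 : ℝ) • (x + v) + (1 / 2 : ℝ) • (x + -v) = x := by module
  rw [hpt, smul_eq_mul, smul_eq_mul] at hmid
  have h1 := hle _ hv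
  have h2 := hle _ hv'
  rw [one_mul, Real.norm_eq_abs, Real.norm_eq_abs]
  refine le_trans ?_ (le_abs_self _)
  rw [map_neg]
  rw [abs_le]
  constructor
  · have := neg_abs_le (h (x + v) - h x - h' v)
    have := abs_nonneg (h (x + -v) - h x - -h' v)
    linarith
  · have := neg_abs_le (h (x + -v) - h x - -h' v)
    have := abs_nonneg (h (x + v) - h x - h' v)
    linarith

lemma concaveOn_sub_mul_normSq_of_le {s : Set E} {f : E → ℝ} {C C' : ℝ}
    (h : ConcaveOn ℝ s fun v => f v - C * ‖v‖ ^ 2) (hC : C ≤ C') :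
    ConcaveOn ℝ s fun v => f v - C' * ‖v‖ ^ 2 := by
  have h1 : ConvexOn ℝ s fun v : E => (C' - C) * ‖v‖ ^ 2 :=
    ((convexOn_norm h.1).pow (fun _ _ => norm_nonneg _) 2).smul (sub_nonneg.2 hC)
  refine (h.sub h1).congr fun v _ => ?_
  simp only [Pi.sub_apply]
  ring

lemma concaveOn_iInf_sub {ι : Type*} [Nonempty ι] {s : Set E} (hs : Convex ℝ s) {F : ι → E → ℝ}
    {q : E → ℝ} (hF : ∀ i, ConcaveOn ℝ s fun v => F i v - q v)
    (hb : ∀ v ∈ s, BddBelow (Set.range fun i => F i v)) :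
    ConcaveOn ℝ s fun v => (⨅ i, F i v) - q v := by
  refine ⟨hs, fun x hx y hy a b ha hb' hab => ?_⟩
  rw [le_sub_iff_add_le]
  refine le_ciInf fun i => ?_
  have h1 := (hF i).2 hx hy ha hb' hab
  have h2 := mul_le_mul_of_nonneg_left (ciInf_le (hb x hx) i) ha
  have h3 := mul_le_mul_of_nonneg_left (ciInf_le (hb y hy) i) hb'
  simp only [smul_eq_mul] at h1 h2 h3 ⊢
  linarith

variable [FiniteDimensional ℝ E] [MeasurableSpace E] [BorelSpace E]

/-- Concave functions on open sets of a finite-dimensional space are locally Lipschitz, so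
Rademacher's theorem applies locally. -/
lemma volume_not_differentiableAt_eq_zero (ν : Measure E) [ν.IsAddHaarMeasure] {s : Set E}
    (hs : IsOpen s) {g : E → ℝ} (hg : ConcaveOn ℝ s g) :
    ν {v ∈ s | ¬ DifferentiableAt ℝ g v} = 0 := by
  refine measure_null_of_locally_null _ fun x hx => ?_
  obtain ⟨K, t, ht, hLip⟩ := hg.locallyLipschitzOn hs hx.1
  rw [hs.nhdsWithin_eq hx.1] at ht
  obtain ⟨u, hut, hu, hxu⟩ := mem_nhds_iff.1 ht
  refine ⟨{v ∈ u | ¬ DifferentiableAt ℝ g v}, ?_, ?_⟩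
  · filter_upwards [mem_nhdsWithin_of_mem_nhds (hu.mem_nhds hxu), self_mem_nhdsWithin] with v hv hv'
    exact ⟨hv, hv'.2⟩
  · have h := (hLip.mono hut).ae_differentiableWithinAt_of_mem (μ := ν)
    refine measure_mono_null ?_ h
    intro v hv h'
    exact hv.2 ((h' hv.1).differentiableAt (hu.mem_nhds hv.1))

end Semiconcave

/-! ### Semi-concavity in the first variable and the envelope -/

section Charts

variable {k : ℕ} {n : Fin (k + 1) → ℕ} {M : Fin (k + 1) → Type*} [∀ i, TopologicalSpace (M i)]
  [∀ i, ChartedSpace (EuclideanSpace ℝ (Fin (n i))) (M i)] {c : (∀ i, M i) → ℝ}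

/-- Freezing the other chart coordinates restricts the concave function to an affine slice; their
squared norms only contribute a constant. -/
lemma IsSemiconcave.exists_ball_nhds (hsc : IsSemiconcave n c) (p : ∀ i, M i) :
    ∃ W ∈ 𝓝 (Fin.tail p), ∃ r > 0, ∃ C : ℝ,
      ∀ z ∈ W, ConcaveOn ℝ (Metric.ball (chartAt (EuclideanSpace ℝ (Fin (n 0))) (p 0) (p 0)) r)
        fun v => c (Fin.cons ((chartAt (EuclideanSpace ℝ (Fin (n 0))) (p 0)).symm v) z)
          - C * ‖v‖ ^ 2 := by
  obtain ⟨U, hU, -, C, hC⟩ := hsc p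
  let e : ∀ i, OpenPartialHomeomorph (M i) (EuclideanSpace ℝ (Fin (n i))) := fun i =>
    chartAt (EuclideanSpace ℝ (Fin (n i))) (p i)
  let Ψ : EuclideanSpace ℝ (Fin (n 0)) × (∀ j : Fin k, M j.succ) →
      ∀ i, EuclideanSpace ℝ (Fin (n i)) := fun y =>
    Fin.cons y.1 fun j => e j.succ (y.2 j)
  have hΨ0 : Ψ (e 0 (p 0), Fin.tail p) = fun i => e i (p i) := by
    funext i
    refine Fin.cases rfl (fun j => rfl) i
  have hΨ : ContinuousAt Ψ (e 0 (p 0), Fin.tail p) := by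
    refine continuousAt_pi.2 fun i => ?_
    refine Fin.cases continuousAt_fst (fun j => ?_) i
    have h1 : ContinuousAt (e j.succ) (p j.succ) :=
      (e j.succ).continuousAt (mem_chart_source _ _)
    exact ContinuousAt.comp
      (f := fun y : EuclideanSpace ℝ (Fin (n 0)) × (∀ j : Fin k, M j.succ) => y.2 j) h1
      ((continuous_apply j).comp continuous_snd).continuousAt
  have hmem : Ψ ⁻¹' U ∈ 𝓝 (e 0 (p 0), Fin.tail p) := hΨ (by rw [hΨ0]; exact hU)
  obtain ⟨B, hB, W, hW, hBW⟩ := mem_nhds_prod_iff.1 hmem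
  obtain ⟨r, hr, hrB⟩ := Metric.mem_nhds_iff.1 hB
  have hsrc : {z : ∀ j : Fin k, M j.succ | ∀ j, z j ∈ (e j.succ).source} ∈ 𝓝 (Fin.tail p) := by
    refine Filter.eventually_all.2 fun j => ?_
    exact (continuous_apply j).continuousAt
      ((e j.succ).open_source.mem_nhds (mem_chart_source _ (p j.succ)))
  refine ⟨W ∩ {z | ∀ j, z j ∈ (e j.succ).source}, Filter.inter_mem hW hsrc, r, hr, C, ?_⟩
  rintro z ⟨hzW, hz⟩
  have hval : ∀ v, (fun i => (e i).symm (Ψ (v, z) i)) = Fin.cons ((e 0).symm v) z := by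
    intro v
    funext i
    refine Fin.cases rfl (fun j => ?_) i
    exact (e j.succ).left_inv (hz j)
  have hsum : ∀ v, ∑ i, ‖Ψ (v, z) i‖ ^ 2 = ‖v‖ ^ 2 + ∑ j : Fin k, ‖e j.succ (z j)‖ ^ 2 := by
    intro v
    rw [Fin.sum_univ_succ]
    rfl
  refine ⟨convex_ball _ _, fun v hv w hw a b ha hb hab => ?_⟩
  have hin := hC.2 (hBW (Set.mk_mem_prod (hrB hv) hzW)) (hBW (Set.mk_mem_prod (hrB hw) hzW))
    ha hb hab
  have hcomb : a • Ψ (v, z) + b • Ψ (w, z) = Ψ (a • v + b • w, z) := by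
    funext i
    refine Fin.cases rfl (fun j => ?_) i
    change a • e j.succ (z j) + b • e j.succ (z j) = e j.succ (z j)
    rw [← add_smul, hab, one_smul]
  rw [hcomb] at hin
  change a • (c (fun i => (e i).symm (Ψ (v, z) i)) - C * ∑ i, ‖Ψ (v, z) i‖ ^ 2)
    + b • (c (fun i => (e i).symm (Ψ (w, z) i)) - C * ∑ i, ‖Ψ (w, z) i‖ ^ 2)
    ≤ c (fun i => (e i).symm (Ψ (a • v + b • w, z) i))
      - C * ∑ i, ‖Ψ (a • v + b • w, z) i‖ ^ 2 at hin
  rw [hval, hval, hval, hsum, hsum, hsum] at hin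
  simp only [smul_eq_mul] at hin ⊢
  change a * (c (Fin.cons ((e 0).symm v) z) - C * ‖v‖ ^ 2)
    + b * (c (Fin.cons ((e 0).symm w) z) - C * ‖w‖ ^ 2)
    ≤ c (Fin.cons ((e 0).symm (a • v + b • w)) z) - C * ‖a • v + b • w‖ ^ 2
  -- The frozen terms carry total weight `a + b`; eliminating `b` lets them cancel.
  obtain rfl : b = 1 - a := by linarith
  linarith

/-- An infimum over infinitely many `z` stays semi-concave only with a common `r` and `C`;
compactness of `K` supplies them. -/
lemma IsSemiconcave.exists_uniform_ball (hsc : IsSemiconcave n c) (x₀ : M 0)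
    {K : Set (∀ j : Fin k, M j.succ)} (hK : IsCompact K) :
    ∃ r > 0, ∃ C : ℝ,
      ∀ z ∈ K, ConcaveOn ℝ (Metric.ball (chartAt (EuclideanSpace ℝ (Fin (n 0))) x₀ x₀) r)
        fun v => c (Fin.cons ((chartAt (EuclideanSpace ℝ (Fin (n 0))) x₀).symm v) z)
          - C * ‖v‖ ^ 2 := by
  refine hK.induction_on ?_ ?_ ?_ ?_
  · exact ⟨1, one_pos, 0, fun z hz => hz.elim⟩
  · rintro s t hst ⟨r, hr, C, h⟩
    exact ⟨r, hr, C, fun z hz => h z (hst hz)⟩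
  · rintro s t ⟨r, hr, C, h⟩ ⟨r', hr', C', h'⟩
    refine ⟨min r r', lt_min hr hr', max C C', ?_⟩
    rintro z (hz | hz)
    · exact concaveOn_sub_mul_normSq_of_le ((h z hz).subset
        (Metric.ball_subset_ball (min_le_left _ _)) (convex_ball _ _)) (le_max_left _ _)
    · exact concaveOn_sub_mul_normSq_of_le ((h' z hz).subset
        (Metric.ball_subset_ball (min_le_right _ _)) (convex_ball _ _)) (le_max_right _ _)
  · intro z _
    obtain ⟨W, hW, h⟩ := hsc.exists_ball_nhds (Fin.cons x₀ z)
    rw [Fin.tail_cons] at hW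
    exact ⟨W, mem_nhdsWithin_of_mem_nhds hW, h⟩

variable [IsManifold (𝓡 (n 0)) 1 (M 0)]

lemma hasMFDerivAt_first_of_hasFDerivAt_chart {z : ∀ j : Fin k, M j.succ} {x x₀ : M 0}
    {D : EuclideanSpace ℝ (Fin (n 0)) →L[ℝ] ℝ}
    (hx : x ∈ (chartAt (EuclideanSpace ℝ (Fin (n 0))) x₀).source)
    (hD : HasFDerivAt
      (fun v => c (Fin.cons ((chartAt (EuclideanSpace ℝ (Fin (n 0))) x₀).symm v) z)) D
      (chartAt (EuclideanSpace ℝ (Fin (n 0))) x₀ x)) :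
    HasMFDerivAt (𝓡 (n 0)) 𝓘(ℝ, ℝ) (fun y : M 0 => c (Fin.cons y z)) x
      (D.comp (mfderiv (𝓡 (n 0)) (𝓡 (n 0)) (chartAt (EuclideanSpace ℝ (Fin (n 0))) x₀) x)) := by
  have h1 := (mdifferentiableAt_atlas (I := 𝓡 (n 0))
    (chart_mem_atlas (EuclideanSpace ℝ (Fin (n 0))) x₀) hx).hasMFDerivAt
  have h2 := HasMFDerivAt.comp x hD.hasMFDerivAt h1
  refine h2.congr_of_eventuallyEq ?_
  filter_upwards [(chartAt (EuclideanSpace ℝ (Fin (n 0))) x₀).open_source.mem_nhds hx] with y hy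
  simp only [Function.comp_apply]
  rw [OpenPartialHomeomorph.left_inv _ hy]

/-- If the points of `S` admit prices, then for almost every `x` the differential of `c` in the
first variable exists at all points of `S` over `x` and is the same for all of them. -/
theorem ae_derivInFirst_eq_of_price [SecondCountableTopology (M 0)] [MeasurableSpace (M 0)]
    {ν : Measure (M 0)} (hν : IsAbsolutelyContinuousInCharts (n 0) ν)
    (hc : Continuous c) (hsc : IsSemiconcave n c) {S : Set (∀ i, M i)}
    {K : Set (∀ j : Fin k, M j.succ)} (hK : IsCompact K) (hSK : ∀ p ∈ S, Fin.tail p ∈ K)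
    {φ : S → ℝ}
    (hφ : ∀ p q : S, c p - φ p ≤ c (Fin.cons (p.1 0) (Fin.tail q.1)) - φ q) :
    ∀ᵐ x ∂ν, ∃ L : TangentSpace (𝓡 (n 0)) x →L[ℝ] ℝ, ∀ p ∈ S, p 0 = x →
      DifferentiableInFirst n c x (Fin.tail p) ∧ derivInFirst n c x (Fin.tail p) = L := by
  rcases isEmpty_or_nonempty S with hS | hS
  · exact Filter.Eventually.of_forall fun x => ⟨0, fun p hp => (hS.false ⟨p, hp⟩).elim⟩
  let p₁ : S := Classical.arbitrary S
  let w : M 0 → ℝ := fun y => ⨅ q : S, (c (Fin.cons y (Fin.tail q.1)) - φ q)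
  have hcons : ∀ y : M 0, Continuous fun z : ∀ j : Fin k, M j.succ =>
      c (Fin.cons y z : ∀ i, M i) := fun y =>
    hc.comp (continuous_pi fun i => Fin.cases continuous_const (fun j => continuous_apply j) i)
  have hbdd : ∀ y, BddBelow (Set.range fun q : S => c (Fin.cons y (Fin.tail q.1)) - φ q) := by
    intro y
    obtain ⟨b, hb⟩ := (hK.image ((hcons y).sub (hcons (p₁.1 0)))).bddBelow
    -- Moving the first coordinate from that of `p₁` to `y` changes the cost by at least `b`,
    -- uniformly over `K`; at `p₁` the price inequality gives the bound.
    refine ⟨b + (c p₁ - φ p₁), ?_⟩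
    rintro _ ⟨q, rfl⟩
    have h1 := hb (Set.mem_image_of_mem _ (hSK q q.2))
    have h2 := hφ p₁ q
    simp only [Pi.sub_apply] at h1 ⊢
    linarith
  have hw : ∀ (y : M 0) (q : S), w y ≤ c (Fin.cons y (Fin.tail q.1)) - φ q := fun y q =>
    ciInf_le (hbdd y) q
  have hw' : ∀ p : S, w (p.1 0) = c (Fin.cons (p.1 0) (Fin.tail p.1)) - φ p := by
    intro p
    refine le_antisymm (hw _ p) (le_ciInf fun q => ?_)
    rw [Fin.cons_self_tail]
    exact hφ p q
  refine measure_null_of_locally_null _ fun x₀ _ => ?_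
  obtain ⟨r, hr, C, hconc⟩ := hsc.exists_uniform_ball x₀ hK
  set e := chartAt (EuclideanSpace ℝ (Fin (n 0))) x₀
  have hsrc : e.source ∩ e ⁻¹' Metric.ball (e x₀) r ∈ 𝓝 x₀ :=
    Filter.inter_mem (e.open_source.mem_nhds (mem_chart_source _ x₀))
      ((e.continuousAt (mem_chart_source _ x₀)) (Metric.ball_mem_nhds _ hr))
  have hwconc : ConcaveOn ℝ (Metric.ball (e x₀) r) fun v => w (e.symm v) - C * ‖v‖ ^ 2 := by
    refine concaveOn_iInf_sub (convex_ball _ _) (fun q => ?_) fun v _ => hbdd _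
    refine ((hconc _ (hSK q q.2)).add_const (-φ q)).congr fun v _ => ?_
    simp only [Pi.add_apply]
    ring
  have hnull := volume_not_differentiableAt_eq_zero volume Metric.isOpen_ball hwconc
  refine ⟨_, Filter.inter_mem self_mem_nhdsWithin (mem_nhdsWithin_of_mem_nhds hsrc),
    measure_mono_null ?_ (hν e (chart_mem_atlas _ x₀) _ hnull)⟩
  rintro x ⟨hx, hxs, hxb⟩
  refine ⟨hxs, hxb, fun hdiff => hx ?_⟩
  have hn : HasFDerivAt (fun v : EuclideanSpace ℝ (Fin (n 0)) => C * ‖v‖ ^ 2)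
      (fderiv ℝ (fun v : EuclideanSpace ℝ (Fin (n 0)) => C * ‖v‖ ^ 2) (e x)) (e x) :=
    ((differentiableAt_id.norm_sq ℝ).const_mul C).hasFDerivAt
  -- The derivative does not involve `p`: it is that of `w` read in the chart at `x₀`.
  have key : ∀ p ∈ S, p 0 = x → HasMFDerivAt (𝓡 (n 0)) 𝓘(ℝ, ℝ)
      (fun y : M 0 => c (Fin.cons y (Fin.tail p))) x
      ((fderiv ℝ (fun v => w (e.symm v) - C * ‖v‖ ^ 2) (e x)
        + fderiv ℝ (fun v : EuclideanSpace ℝ (Fin (n 0)) => C * ‖v‖ ^ 2) (e x)).comp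
        (mfderiv (𝓡 (n 0)) (𝓡 (n 0)) e x)) := by
    intro p hp hpx
    refine hasMFDerivAt_first_of_hasFDerivAt_chart hxs ?_
    have h1 : ConcaveOn ℝ (Metric.ball (e x₀) r)
        fun v => c (Fin.cons (e.symm v) (Fin.tail p)) - C * ‖v‖ ^ 2 + -φ ⟨p, hp⟩ :=
      (hconc _ (hSK p hp)).add_const _
    have h2 := hasFDerivAt_of_concaveOn_of_le (Metric.isOpen_ball.mem_nhds hxb) h1
      (fun v _ => by linarith [hw (e.symm v) ⟨p, hp⟩])
      (by
        have h3 := hw' ⟨p, hp⟩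
        simp only [hpx] at h3
        simp only [e.left_inv hxs]
        linarith) hdiff.hasFDerivAt
    have h4 := (h2.add hn).add_const (φ ⟨p, hp⟩)
    refine h4.congr_of_eventuallyEq (Filter.Eventually.of_forall fun v => ?_)
    simp only [Pi.add_apply]
    ring
  exact ⟨_, fun p hp hpx => ⟨(key p hp hpx).mdifferentiableAt, (key p hp hpx).mfderiv⟩⟩

end Charts

/-! ### From single-point fibres to a Borel map -/

section Graphs

variable {k : ℕ} {M : Fin (k + 1) → Type*} [∀ i, TopologicalSpace (M i)] [∀ i, T2Space (M i)]
  [∀ i, SecondCountableTopology (M i)] [∀ i, MeasurableSpace (M i)] [∀ i, BorelSpace (M i)]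

/-- A measure carried by a compact set whose fibres over almost every point of the first factor
have at most one point is concentrated on the graph of a Borel map. -/
theorem inducesMongeSolution_of_fibre_subsingleton [∀ i, Nonempty (M i)]
    {γ : Measure (∀ i, M i)} {S : Set (∀ i, M i)}
    (hS : IsCompact S) (hγS : ∀ᵐ x ∂γ, x ∈ S)
    (hfib : ∀ᵐ x ∂(γ.map fun x => x 0), ∀ p ∈ S, ∀ q ∈ S, p 0 = x → q 0 = x → p = q) :
    InducesMongeSolution γ := by
  obtain ⟨A, hA, hAm, hA0⟩ := exists_measurable_superset_of_null hfib
  have hγA : ∀ᵐ x ∂γ, x 0 ∉ A :=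
    ae_of_ae_map (measurable_pi_apply 0).aemeasurable (p := fun y => y ∉ A)
      (measure_eq_zero_iff_ae_notMem.1 hA0)
  have : CompactSpace S := isCompact_iff_compactSpace.1 hS
  let _ : MetricSpace S := TopologicalSpace.metrizableSpaceMetric S
  let s : Set S := {p | p.1 0 ∉ A}
  have h0 : Measurable fun p : S => p.1 0 :=
    (measurable_pi_apply 0).comp measurable_subtype_coe
  have hs : MeasurableSet s := h0 hAm.compl
  have : StandardBorelSpace s := hs.standardBorel
  -- Lusin–Souslin: an injective Borel map on a standard Borel space is a measurable embedding, so
  -- its inverse followed by the tail is Borel and extends to `T`.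
  have hemb : MeasurableEmbedding fun p : s => p.1.1 0 := by
    refine (h0.comp measurable_subtype_coe).measurableEmbedding fun p q hpq => ?_
    have hp : ¬ p.1.1 0 ∈ A := p.2
    have h : ∀ p' ∈ S, ∀ q' ∈ S, p' 0 = p.1.1 0 → q' 0 = p.1.1 0 → p' = q' :=
      not_not.1 fun h => hp (hA h)
    exact Subtype.ext (Subtype.ext (h _ p.1.2 _ q.1.2 rfl hpq.symm))
  have htail : Measurable fun p : s => (fun j : Fin k => p.1.1 j.succ : ∀ j : Fin k, M j.succ) :=
    measurable_pi_lambda _ fun j =>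
      (measurable_pi_apply j.succ).comp (measurable_subtype_coe.comp measurable_subtype_coe)
  obtain ⟨T, hT, hTe⟩ := hemb.exists_measurable_extend htail fun _ => inferInstance
  refine ⟨T, hT, ?_⟩
  filter_upwards [hγS, hγA] with x hxS hxA
  exact (congrFun hTe ⟨⟨x, hxS⟩, hxA⟩).symm

end Graphs

/-! ### Uniqueness by averaging -/

section Uniqueness

variable {k : ℕ} {M : Fin (k + 1) → Type*} [∀ i, MeasurableSpace (M i)]
  {μ : ∀ i, Measure (M i)} {c : (∀ i, M i) → ℝ}

lemma measurable_finCons_graph {T : M 0 → ∀ j : Fin k, M j.succ} (hT : Measurable T) :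
    Measurable fun y : M 0 => (Fin.cons y (T y) : ∀ i, M i) :=
  measurable_pi_lambda _ fun i =>
    Fin.cases measurable_id (fun j => (measurable_pi_apply j).comp hT) i

lemma IsPlan.eq_map_graph {γ : Measure (∀ i, M i)} (h : IsPlan μ γ)
    {T : M 0 → ∀ j : Fin k, M j.succ} (hT : Measurable T)
    (hγ : ∀ᵐ x ∂γ, (fun j : Fin k => x j.succ) = T (x 0)) :
    γ = (μ 0).map fun y => Fin.cons y (T y) := by
  rw [← h.map_eval 0, Measure.map_map (measurable_finCons_graph hT) (measurable_pi_apply 0)]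
  conv_lhs => rw [← Measure.map_id (μ := γ)]
  refine Measure.map_congr ?_
  filter_upwards [hγ] with x hx
  rw [Function.comp_apply, ← hx]
  exact (Fin.cons_self_tail x).symm

/-- The average of two optimal plans is optimal. -/
lemma IsOptimalPlan.average {γ γ' : Measure (∀ i, M i)} [∀ i, IsProbabilityMeasure (μ i)]
    (hint : ∀ γ, IsPlan μ γ → Integrable c γ)
    (h : IsOptimalPlan c μ γ) (h' : IsOptimalPlan c μ γ') :
    IsOptimalPlan c μ ((2⁻¹ : ENNReal) • (γ + γ')) := by
  refine ⟨IsPlan.of_map_eval fun i => ?_, fun ρ hρ => ?_⟩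
  · rw [Measure.map_smul, Measure.map_add _ _ (measurable_pi_apply i), h.1.map_eval, h'.1.map_eval,
      ← two_smul ENNReal (μ i), smul_smul, ENNReal.inv_mul_cancel two_ne_zero ENNReal.ofNat_ne_top,
      one_smul]
  · rw [integral_smul_measure, integral_add_measure (hint _ h.1) (hint _ h'.1)]
    have h1 := h.2 ρ hρ
    have h2 := h'.2 ρ hρ
    simp only [ENNReal.toReal_inv, ENNReal.toReal_ofNat, smul_eq_mul]
    linarith

/-- If every optimal plan is concentrated on a graph, there is at most one optimal plan. -/
theorem IsOptimalPlan.unique_of_inducesMongeSolution {γ γ' : Measure (∀ i, M i)}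
    [∀ i, IsProbabilityMeasure (μ i)] (hint : ∀ γ, IsPlan μ γ → Integrable c γ)
    (hM : ∀ γ, IsOptimalPlan c μ γ → InducesMongeSolution γ)
    (h : IsOptimalPlan c μ γ) (h' : IsOptimalPlan c μ γ') : γ = γ' := by
  obtain ⟨T, hT, hae⟩ := hM _ (h.average hint h')
  have h2 : (2⁻¹ : ENNReal) ≠ 0 := ENNReal.inv_ne_zero.2 ENNReal.ofNat_ne_top
  have hae' := ae_add_measure_iff.1 ((Measure.ae_ennreal_smul_measure_iff h2).1 hae)
  rw [h.1.eq_map_graph hT hae'.1, h'.1.eq_map_graph hT hae'.2]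

end Uniqueness

/-! ### Conclusion from the twist condition -/

section Main

theorem IsCyclicallyMonotone.mono {k : ℕ} {M : Fin (k + 1) → Type*} {c : (∀ i, M i) → ℝ}
    {S S' : Set (∀ i, M i)} (h : IsCyclicallyMonotone c S) (hS : S' ⊆ S) :
    IsCyclicallyMonotone c S' :=
  fun N X hX σ => h N X (fun l => hS (hX l)) σ

variable {k : ℕ} {n : Fin (k + 1) → ℕ} {M : Fin (k + 1) → Type*}
  [∀ i, TopologicalSpace (M i)] [∀ i, T2Space (M i)] [∀ i, SecondCountableTopology (M i)]
  [∀ i, ChartedSpace (EuclideanSpace ℝ (Fin (n i))) (M i)]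
  [IsManifold (𝓡 (n 0)) 1 (M 0)] [∀ i, MeasurableSpace (M i)] [∀ i, BorelSpace (M i)]

theorem IsOptimalPlan.inducesMongeSolution
    {μ : ∀ i, Measure (M i)} [∀ i, IsProbabilityMeasure (μ i)]
    (hμ : ∀ i, IsCompact (μ i).support)
    {c : (∀ i, M i) → ℝ} (hc : Continuous c) (hsc : IsSemiconcave n c)
    (htwist : IsTwistedInCyclicalMonotonicity n c)
    (hac : IsAbsolutelyContinuousInCharts (n 0) (μ 0))
    {γ : Measure (∀ i, M i)} (h : IsOptimalPlan c μ γ) : InducesMongeSolution γ := by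
  have hne : ∀ i, Nonempty (M i) := fun i => nonempty_of_isProbabilityMeasure (μ i)
  have hcm := h.isCyclicallyMonotone_support hμ hc
  have hsub : γ.support ⊆ supportBox μ :=
    Measure.support_subset_of_isClosed isClosed_supportBox h.1.ae_mem_supportBox
  have hcomp : IsCompact γ.support :=
    (isCompact_supportBox hμ).of_isClosed_subset Measure.isClosed_support hsub
  have htail : Continuous fun x : ∀ i, M i => Fin.tail x :=
    continuous_pi fun j => continuous_apply j.succ
  obtain ⟨φ, hφ⟩ := exists_price_of_cyclicallyMonotone (P := γ.support)
    (b := fun p q => c (Fin.cons (p.1 0) (Fin.tail q.1))) fun N p σ => by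
      have h1 := hcm N (fun l => (p l).1) (fun l => (p l).2)
        -- The first factor stays fixed and the others move together, so only the pairing of `p 0`
        -- with tails changes.
        (Fin.cons (Equiv.refl _) fun _ => σ)
      simp only [Fin.cons_self_tail]
      refine h1.trans_eq (Finset.sum_congr rfl fun l _ => congrArg c ?_)
      funext i
      exact Fin.cases rfl (fun j => rfl) i
  simp only [Fin.cons_self_tail] at hφ
  have hae := ae_derivInFirst_eq_of_price hac hc hsc (hcomp.image htail)
    (fun p hp => Set.mem_image_of_mem _ hp) hφ
  refine inducesMongeSolution_of_fibre_subsingleton hcomp Measure.support_mem_ae ?_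
  rw [h.1.map_eval 0]
  filter_upwards [hae] with x hx
  obtain ⟨L, hL⟩ := hx
  intro p hp q hq hpx hqx
  have hmem : ∀ p ∈ γ.support, p 0 = x →
      (Fin.cons x (Fin.tail p) : ∀ i, M i) ∈ γ.support ∩ {p | p 0 = x} := by
    rintro p hp rfl
    rw [Fin.cons_self_tail]
    exact ⟨hp, rfl⟩
  have htw := htwist x (γ.support ∩ {p | p 0 = x}) (fun p hp => hp.2)
    (hcm.mono Set.inter_subset_left)
    ⟨hmem p hp hpx, (hL p hp hpx).1⟩ ⟨hmem q hq hqx, (hL q hq hqx).1⟩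
    ((hL p hp hpx).2.trans (hL q hq hqx).2.symm)
  rw [← Fin.cons_self_tail p, ← Fin.cons_self_tail q, htw, hpx, hqx]

end Main

end MultiMarginal

theorem corollary3p2 {k : ℕ} (n : Fin (k + 1) → ℕ) {M : Fin (k + 1) → Type*}
    [∀ i, TopologicalSpace (M i)] [∀ i, T2Space (M i)] [∀ i, SecondCountableTopology (M i)]
    [∀ i, ChartedSpace (EuclideanSpace ℝ (Fin (n i))) (M i)]
    [∀ i, IsManifold (𝓡 (n i)) ∞ (M i)]
    [∀ i, MeasurableSpace (M i)] [∀ i, BorelSpace (M i)]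
    (μ : ∀ i, Measure (M i)) [∀ i, IsProbabilityMeasure (μ i)]
    (hμ : ∀ i, IsCompact (μ i).support)
    (c : (∀ i, M i) → ℝ) (hc : Continuous c) (hsc : MultiMarginal.IsSemiconcave n c)
    (htwist : MultiMarginal.IsTwistedInCyclicalMonotonicity n c)
    (hac : MultiMarginal.IsAbsolutelyContinuousInCharts (n 0) (μ 0)) :
    (∃! γ : Measure (∀ i, M i), MultiMarginal.IsOptimalPlan c μ γ) ∧
      ∀ γ : Measure (∀ i, M i), MultiMarginal.IsOptimalPlan c μ γ →
        MultiMarginal.InducesMongeSolution γ := by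
  have hmetr : ∀ i, TopologicalSpace.MetrizableSpace (M i) := fun i =>
    have := ChartedSpace.locallyCompactSpace (EuclideanSpace ℝ (Fin (n i))) (M i)
    Manifold.metrizableSpace (𝓡 (n i)) (M i)
  have hman : IsManifold (𝓡 (n 0)) 1 (M 0) := IsManifold.of_le (n := ∞) (by simp)
  have hmonge : ∀ γ, MultiMarginal.IsOptimalPlan c μ γ → MultiMarginal.InducesMongeSolution γ :=
    fun γ h => h.inducesMongeSolution hμ hc hsc htwist hac
  obtain ⟨γ, hγ⟩ := MultiMarginal.exists_isOptimalPlan hμ hc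
  exact ⟨⟨γ, hγ, fun γ' h => MultiMarginal.IsOptimalPlan.unique_of_inducesMongeSolution
    (fun _ h => h.integrable hμ hc) hmonge h hγ⟩, hmonge⟩
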